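/- **Theorem.** Consider the determining system $$\xi^0_t+2\xi^0\xi^0_x+\xi^0_{xx}-2\eta^1_x=0,\qquad \eta^1_t+2\xi^0_x\eta^1+\eta^1_{xx}+\eta^0_x=0,\qquad \eta^0_t+2\xi^0_x\eta^0+\eta^0_{xx}=0$$ for real-valued smooth functions $\xi^0,\eta^1,\eta^0$ of $(t,x)$. These are the determining equations for the coefficients of the reduction operators $\partial_t+\left(-\tfrac12u+\xi^0\right)\partial_x+\left(\tfrac14u^3-\tfrac12\xi^0u^2+\eta^1u+\eta^0\right)\partial_u$ of the Burgers equation $u_t+uu_x+u_{xx}=0$ (the no-go case $\tau=1$, $\xi_u=-\tfrac12$). For a triple $\bar v=(v^1,v^2,v^3)$ of functions of $(t,x)$, let $|\bar p,\bar q,\bar r|$ denote the determinant of the $3\times3$ matrix with columns $\bar p,\bar q,\bar r$, and let $W(\bar v)=|\bar v,\bar v_x,\bar v_{xx}|$ and $W(\bar v_x)=|\bar v_x,\bar v_{xx},\bar v_{xxx}|$ be the Wronskians with respect to $x$ of $\bar v$ and of $\bar v_x$. (i) Let $(\xi^0,\eta^1,\eta^0)$ be a smooth solution of the determining system on an open set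 $\Omega\subseteq\mathbb R^2$. Then on every simply connected open set $U\subseteq\Omega$ (in particular near every point of $\Omega$, and on $\Omega$ itself if $\Omega$ is simply connected) there is a triple $\bar v=(v^1,v^2,v^3)$ of linearly independent smooth solutions of the heat equation $v_t+v_{xx}=0$ such that $W(\bar v)$ vanishes nowhere on $U$ and, on $U$, $$\xi^0=\frac{(W(\bar v))_x}{W(\bar v)},\qquad \eta^1=\frac{|\bar v,\bar v_{xx},\bar v_{xxx}|}{W(\bar v)},\qquad \eta^0=-2\,\frac{W(\bar v_x)}{W(\bar v)}.\qquad(*)$$ (ii) Conversely, let $\bar v$ be a triple of linearly independent smooth solutions of the heat equation $v_t+v_{xx}=0$ on an open set $\Omega\subseteq\mathbb R^2$ with $W(\bar v)\neq0$ everywhere on $\Omega$. Then the triple $(\xi^0,\eta^1,\eta^0)$ given by $(*)$ on $\Omega$ is smooth and satisfies the determining system on $\Omega$. -/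

import Mathlib

open scoped ContDiff

/-- The partial derivative `f_t` of a function `f` of `(t, x)`. -/
noncomputable def Dt (f : ℝ × ℝ → ℝ) (p : ℝ × ℝ) : ℝ :=
  deriv (fun t => f (t, p.2)) p.1

/-- The partial derivative `f_x` of a function `f` of `(t, x)`. -/
noncomputable def Dx (f : ℝ × ℝ → ℝ) (p : ℝ × ℝ) : ℝ :=
  deriv (fun x => f (p.1, x)) p.2

/-- `(ξ⁰, η¹, η⁰)` is a smooth solution on `Ω` of the determining system
`ξ⁰_t + 2 ξ⁰ ξ⁰_x + ξ⁰_xx - 2 η¹_x = 0`, `η¹_t + 2 ξ⁰_x η¹ + η¹_xx + η⁰_x = 0`,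
`η⁰_t + 2 ξ⁰_x η⁰ + η⁰_xx = 0` for the coefficients of the reduction operators
`∂_t + (-u/2 + ξ⁰) ∂_x + (u³/4 - ξ⁰ u²/2 + η¹ u + η⁰) ∂_u` of the Burgers equation. -/
structure SolvesDeterminingSystem (Ω : Set (ℝ × ℝ)) (ξ0 η1 η0 : ℝ × ℝ → ℝ) : Prop where
  smooth_ξ0 : ContDiffOn ℝ ∞ ξ0 Ω
  smooth_η1 : ContDiffOn ℝ ∞ η1 Ω
  smooth_η0 : ContDiffOn ℝ ∞ η0 Ω
  eq1 : ∀ p ∈ Ω, Dt ξ0 p + 2 * ξ0 p * Dx ξ0 p + Dx (Dx ξ0) p - 2 * Dx η1 p = 0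
  eq2 : ∀ p ∈ Ω, Dt η1 p + 2 * Dx ξ0 p * η1 p + Dx (Dx η1) p + Dx η0 p = 0
  eq3 : ∀ p ∈ Ω, Dt η0 p + 2 * Dx ξ0 p * η0 p + Dx (Dx η0) p = 0

/-- `v = (v¹, v², v³)` is a triple of linearly independent smooth solutions on `Ω` of the
heat equation `v_t + v_xx = 0`. -/
structure IsHeatTriple (Ω : Set (ℝ × ℝ)) (v : Fin 3 → ℝ × ℝ → ℝ) : Prop where
  smooth : ∀ i, ContDiffOn ℝ ∞ (v i) Ω
  heat : ∀ i, ∀ p ∈ Ω, Dt (v i) p + Dx (Dx (v i)) p = 0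
  linearIndependent : LinearIndependent ℝ (fun i => Ω.domRestrict (v i))

/-- The triple of `x`-derivatives. -/
noncomputable def DxT (v : Fin 3 → ℝ × ℝ → ℝ) : Fin 3 → ℝ × ℝ → ℝ := fun i => Dx (v i)

/-- The determinant `|a, b, c|` of the matrix with columns `a`, `b`, `c`, as a function of
`(t, x)`. -/
noncomputable def det3 (a b c : Fin 3 → ℝ × ℝ → ℝ) (p : ℝ × ℝ) : ℝ :=
  Matrix.det (Matrix.of fun i : Fin 3 => ![a i p, b i p, c i p])

/-- The Wronskian `W(v) = |v, v_x, v_xx|` with respect to `x`. -/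
noncomputable def wronskian3 (v : Fin 3 → ℝ × ℝ → ℝ) : ℝ × ℝ → ℝ :=
  det3 v (DxT v) (DxT (DxT v))

/-- On `Ω` the Wronskian `W(v)` has no zeros and `ξ⁰ = W(v)_x / W(v)`,
`η¹ = |v, v_xx, v_xxx| / W(v)`, `η⁰ = -2 W(v_x) / W(v)`. -/
structure IsRepresentedBy (Ω : Set (ℝ × ℝ)) (v : Fin 3 → ℝ × ℝ → ℝ)
    (ξ0 η1 η0 : ℝ × ℝ → ℝ) : Prop where
  wronskian_ne_zero : ∀ p ∈ Ω, wronskian3 v p ≠ 0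
  ξ0_eq : ∀ p ∈ Ω, ξ0 p = Dx (wronskian3 v) p / wronskian3 v p
  η1_eq : ∀ p ∈ Ω, η1 p = det3 v (DxT (DxT v)) (DxT (DxT (DxT v))) p / wronskian3 v p
  η0_eq : ∀ p ∈ Ω, η0 p = -2 * (wronskian3 (DxT v) p / wronskian3 v p)

/-! With `a = -η⁰/2`, `b = -η¹`, `c = ξ⁰`, the determining system is the compatibility condition of
the heat equation `y_t = -y_xx` with the linear equation `y_xxx = a y + b y_x + c y_xx`.

For the converse part, Cramer's rule shows that the components of `v` solve such an equation with
the coefficients of `(*)`. Applying `∂_t + ∂_xx` to it leaves a linear relation between `v`, `v_x`,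
`v_xx` (`heat_compatibility`), and `W(v) ≠ 0` forces its three coefficients to vanish; these are the
three determining equations.

For the direct part, the pair of equations is rewritten as `Φ_x = A Φ`, `Φ_t = B Φ` for the vector
`(y, y_x, y_xx)`. The determining system makes the connection `B dt + A dx` flat
(`companion_evolution_flat`), so a simply connected `U` carries a global invertible solution `Φ`
(`exists_flat_frame`): radial parallel transport gives local frames, two of which differ by locally
constant right factors, and a covering-space argument glues them. The first row of `Φ` is the
required triple. -/

/-! ### Gluing local sections over a simply connected space -/

/-- A type with the discrete topology. -/
@[ext]
structure DiscreteCopy (G : Type*) where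
  /-- The underlying element. -/
  val : G

instance (G : Type*) : TopologicalSpace (DiscreteCopy G) := ⊥

instance (G : Type*) : DiscreteTopology (DiscreteCopy G) := ⟨rfl⟩

open Topology in
/-- Group-valued local sections that differ by locally constant right factors
glue to a global section over a simply connected space. -/
theorem exists_global_section {X G : Type*} [TopologicalSpace X] [SimplyConnectedSpace X]
    [LocallyPathConnectedSpace X] [Group G] (V : X → Set X) (hV : ∀ i, IsOpen (V i))
    (hmem : ∀ i, i ∈ V i) (φ : X → X → G)
    (h : ∀ i j, ∀ x ∈ V i ∩ V j, ∀ᶠ y in 𝓝 x, (φ j y)⁻¹ * φ i y = (φ j x)⁻¹ * φ i x) :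
    ∃ ψ : X → G, ∀ x, ∃ c, ∀ᶠ y in 𝓝 x, ψ y = φ x y * c := by
  -- The transition functions `φ j⁻¹ φ i` are locally constant, so they define a bundle with
  -- discrete fibre `G`, that is, a covering of `X`.
  let Z : FiberBundleCore X X (DiscreteCopy G) :=
    { baseSet := V
      isOpen_baseSet := hV
      indexAt := id
      mem_baseSet_at := hmem
      coordChange := fun i j p g => ⟨(φ j p)⁻¹ * φ i p * g.val⟩
      coordChange_self := by
        intro i x _ v
        ext
        simp
      continuousOn_coordChange := by
        rintro i j ⟨x, g⟩ ⟨hx, -⟩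
        apply ContinuousAt.continuousWithinAt
        rw [ContinuousAt, nhds_discrete (DiscreteCopy G), Filter.tendsto_pure]
        have h1 : ∀ᶠ p : X × DiscreteCopy G in 𝓝 (x, g), p.2 = g := by
          have := (continuous_snd (X := X) (Y := DiscreteCopy G)).tendsto (x, g)
          rw [nhds_discrete (DiscreteCopy G), Filter.tendsto_pure] at this
          exact this
        have h2 : ∀ᶠ p : X × DiscreteCopy G in 𝓝 (x, g),
            (φ j p.1)⁻¹ * φ i p.1 = (φ j x)⁻¹ * φ i x :=
          ((continuous_fst (X := X) (Y := DiscreteCopy G)).tendsto (x, g)).eventually (h i j x hx)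
        filter_upwards [h1, h2] with p hp1 hp2
        rw [hp1, hp2]
      coordChange_comp := by
        intro i j k x _ v
        ext
        simp only
        group }
  obtain ⟨x₀⟩ : Nonempty X := inferInstance
  have cov : IsCoveringMap
      (Bundle.TotalSpace.proj : Bundle.TotalSpace (DiscreteCopy G) Z.Fiber → X) :=
    FiberBundle.isCoveringMap
  -- Simple connectedness enters here: the identity of `X` lifts to the covering, giving a global
  -- section.
  obtain ⟨F, ⟨-, hF⟩, -⟩ := cov.existsUnique_continuousMap_lifts (ContinuousMap.id X) x₀
    ⟨x₀, (⟨1⟩ : DiscreteCopy G)⟩ rfl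
  have hF' : ∀ x, (F x).1 = x := fun x => congrFun hF x
  refine ⟨fun x => φ x x * DiscreteCopy.val (F x).2, fun x => ?_⟩
  have hs : (F x) ∈ (Z.localTriv x).source := by
    change (F x).1 ∈ V x
    rw [hF']
    exact hmem x
  -- Read in the fixed chart at `x`, the section is continuous into a discrete fibre, hence locally
  -- constant; its value is the factor `c`.
  have hc : ContinuousAt (fun y => (Z.localTriv x (F y)).2) x :=
    continuous_snd.continuousAt.comp
      (((Z.localTriv x).continuousAt hs).comp F.continuous.continuousAt)
  rw [ContinuousAt, nhds_discrete (DiscreteCopy G), Filter.tendsto_pure] at hc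
  refine ⟨(Z.localTriv x (F x)).2.val, hc.mono fun y hy => ?_⟩
  rw [← hy]
  change φ y y * DiscreteCopy.val (F y).2 = φ x y *
    ((φ x (F y).1)⁻¹ * φ (F y).1 (F y).1 * DiscreteCopy.val (F y).2)
  rw [hF']
  group

/-! ### Parallel frames of flat connections -/

section Flat

open Topology Set Metric

variable {E R : Type*} [NormedAddCommGroup E] [NormedSpace ℝ E]
  [NormedRing R] [NormedAlgebra ℝ R]

/-- The linear initial value problem `α' = a α`, `α 0 = 1` on `[0, 1]` with a small coefficient. -/
theorem exists_hasDerivWithinAt_mul_of_small [CompleteSpace R] (a : ℝ → R)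
    (ha : ContinuousOn a (Icc 0 1))
    (hsmall : ∀ s ∈ Icc (0 : ℝ) 1, ‖a s‖ * (‖(1 : R)‖ + 1) ≤ 1) :
    ∃ α : ℝ → R, α 0 = 1 ∧
      ∀ s ∈ Icc (0 : ℝ) 1, HasDerivWithinAt α (a s * α s) (Icc 0 1) s := by
  have h1 : ∀ s ∈ Icc (0 : ℝ) 1, ‖a s‖ ≤ 1 := fun s hs => by
    nlinarith [hsmall s hs, mul_nonneg (norm_nonneg (a s)) (norm_nonneg (1 : R))]
  -- On the unit ball about `1` one has `‖y‖ ≤ ‖1‖ + 1`, so the speed is at most `1` and the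
  -- solution cannot leave the ball during `[0, 1]`. The norm of `1` is kept because it need not
  -- equal `1`.
  have hpl : IsPicardLindelof (fun s y => a s * y) (⟨0, by simp⟩ : Icc (0 : ℝ) 1) (1 : R)
      1 0 1 1 :=
    { lipschitzOnWith := by
        intro s hs
        apply LipschitzWith.lipschitzOnWith
        refine LipschitzWith.of_dist_le_mul fun x y => ?_
        rw [dist_eq_norm, dist_eq_norm, ← mul_sub]
        exact (norm_mul_le _ _).trans
          (mul_le_mul_of_nonneg_right (by simpa using h1 s hs) (norm_nonneg _))
      continuousOn := fun x _ => ha.mul continuousOn_const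
      norm_le := by
        intro s hs x hx
        have hx' : ‖x‖ ≤ ‖(1 : R)‖ + 1 := by
          have := norm_le_norm_add_norm_sub' x 1
          rw [mem_closedBall, dist_eq_norm] at hx
          simp only [NNReal.coe_one] at hx
          linarith
        calc ‖a s * x‖ ≤ ‖a s‖ * ‖x‖ := norm_mul_le _ _
          _ ≤ ‖a s‖ * (‖(1 : R)‖ + 1) := by gcongr
          _ ≤ _ := by simpa using hsmall s hs
      mul_max_le := by simp }
  exact hpl.exists_eq_forall_mem_Icc_hasDerivWithinAt₀

/-- The linear map `k ↦ A k * y`. -/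
noncomputable def mulRight (A : E →L[ℝ] R) (y : R) : E →L[ℝ] R :=
  ((ContinuousLinearMap.mul ℝ R).flip y).comp A

@[simp] theorem mulRight_apply (A : E →L[ℝ] R) (y : R) (k : E) : mulRight A y k = A k * y := rfl

/-- The connection form `A` has zero curvature at `p`. -/
def IsFlatAt (A : E → E →L[ℝ] R) (p : E) : Prop :=
  ∀ d k, fderiv ℝ A p d k + A p k * A p d = fderiv ℝ A p k d + A p d * A p k

/-- `α` is the parallel transport of `1` along the segment from `p₀` to `p`. -/
def IsTransport (A : E → E →L[ℝ] R) (p₀ p : E) (α : ℝ → R) : Prop :=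
  α 0 = 1 ∧ ∀ s ∈ Icc (0 : ℝ) 1,
    HasDerivWithinAt α (A (p₀ + s • (p - p₀)) (p - p₀) * α s) (Icc 0 1) s

theorem add_smul_mem_ball {p₀ p : E} {ρ : ℝ} (hp : p ∈ ball p₀ ρ) {s : ℝ}
    (hs : s ∈ Icc (0 : ℝ) 1) : p₀ + s • (p - p₀) ∈ ball p₀ ρ :=
  (convex_ball p₀ ρ).add_smul_sub_mem (mem_ball_self (pos_of_mem_ball hp)) hp hs

/-- `(1 + s A(q - p)) α` solves the transport equation towards `q` up to a quadratic error, if `α`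
solves the one towards `p` and the connection `A` is flat. -/
theorem transport_residual_bound {A : E → E →L[ℝ] R} {p₀ : E} {ρ M N K : ℝ} (hM : 0 ≤ M)
    (hN : 0 ≤ N) (hK : 0 ≤ K)
    (hdiff : ∀ p ∈ ball p₀ ρ, DifferentiableAt ℝ A p)
    (hAM : ∀ p ∈ ball p₀ ρ, ‖A p‖ ≤ M) (hDN : ∀ p ∈ ball p₀ ρ, ‖fderiv ℝ A p‖ ≤ N)
    (hDK : ∀ p ∈ ball p₀ ρ, ∀ q ∈ ball p₀ ρ, ‖fderiv ℝ A q - fderiv ℝ A p‖ ≤ K * ‖q - p‖)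
    (hflat : ∀ p ∈ ball p₀ ρ, IsFlatAt A p) {p q : E} (hp : p ∈ ball p₀ ρ) (hq : q ∈ ball p₀ ρ)
    {s : ℝ} (hs : s ∈ Icc (0 : ℝ) 1) :
    ‖(A (p₀ + s • (p - p₀)) (q - p)
        + s • fderiv ℝ A (p₀ + s • (p - p₀)) (p - p₀) (q - p))
      + (1 + s • A (p₀ + s • (p - p₀)) (q - p)) * A (p₀ + s • (p - p₀)) (p - p₀)
      - A (p₀ + s • (q - p₀)) (q - p₀) * (1 + s • A (p₀ + s • (p - p₀)) (q - p))‖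
      ≤ ((K * ρ + N) + (M + N * ρ + (K * ρ + N) * (2 * ρ)) * M) * ‖q - p‖ ^ 2 := by
  set x := p₀ + s • (p - p₀) with hx
  set y := p₀ + s • (q - p₀) with hy
  have hxb : x ∈ ball p₀ ρ := add_smul_mem_ball hp hs
  have hyb : y ∈ ball p₀ ρ := add_smul_mem_ball hq hs
  have hyx : y - x = s • (q - p) := by rw [hx, hy]; module
  set k := q - p with hk
  set d := p - p₀ with hd
  have hdk : q - p₀ = d + k := by rw [hd, hk]; abel
  have hρ : 0 < ρ := pos_of_mem_ball hp
  have hdρ : ‖d‖ ≤ ρ := by rw [mem_ball, dist_eq_norm] at hp; exact hp.le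
  have hdkρ : ‖d + k‖ ≤ ρ := by rw [← hdk]; rw [mem_ball, dist_eq_norm] at hq; exact hq.le
  have hkρ : ‖k‖ ≤ 2 * ρ := by
    have : k = (d + k) - d := by abel
    rw [this]; linarith [norm_sub_le (d + k) d]
  have hs0 : |s| ≤ 1 := abs_le.2 ⟨by linarith [hs.1], hs.2⟩
  have hyxk : ‖y - x‖ ≤ ‖k‖ := by
    rw [hyx, norm_smul]; exact mul_le_of_le_one_left (norm_nonneg _) hs0
  have htaylor : ‖A y - A x - fderiv ℝ A x (y - x)‖ ≤ (K * ‖k‖) * ‖k‖ := by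
    have hsub : segment ℝ x y ⊆ ball p₀ ρ := (convex_ball p₀ ρ).segment_subset hxb hyb
    refine ((convex_segment x y).norm_image_sub_le_of_norm_fderiv_le' (𝕜 := ℝ)
      (C := K * ‖k‖) (fun z hz => hdiff z (hsub hz)) (fun z hz => ?_)
      (left_mem_segment ℝ x y) (right_mem_segment ℝ x y)).trans (by gcongr)
    refine (hDK x hxb z (hsub hz)).trans ?_
    gcongr
    refine le_trans ?_ hyxk
    obtain ⟨θ, hθ, rfl⟩ := (segment_eq_image' ℝ x y ▸ hz)
    rw [add_sub_cancel_left, norm_smul]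
    exact mul_le_of_le_one_left (norm_nonneg _) (abs_le.2 ⟨by linarith [hθ.1], hθ.2⟩)
  set D := fderiv ℝ A x with hD
  have hDN' : ‖D‖ ≤ N := hDN x hxb
  have hf := hflat x hxb d k
  rw [← hD] at hf
  -- All the quadratic terms in the expansion of `A y (d + k)` about `x`: the Taylor remainder and
  -- `s D k k`.
  set e := (A y - A x - D (y - x)) (d + k) + s • D k k with he
  have hyexp : A y (q - p₀) = A x d + A x k + s • D k d + e := by
    rw [hdk, he, hyx]
    simp only [sub_apply, map_add, map_smul, smul_apply]
    abel
  have hDk : ‖D k‖ ≤ N * ‖k‖ := (D.le_opNorm k).trans (by gcongr)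
  have hsD : ∀ u : E, ‖s • D k u‖ ≤ N * ‖k‖ * ‖u‖ := fun u => by
    rw [norm_smul]
    exact (mul_le_of_le_one_left (norm_nonneg _) hs0).trans
      (((D k).le_opNorm u).trans (by gcongr))
  have he1 : ‖e‖ ≤ (K * ρ + N) * ‖k‖ ^ 2 := by
    refine (norm_add_le _ _).trans ?_
    have h1 : ‖(A y - A x - D (y - x)) (d + k)‖ ≤ (K * ‖k‖) * ‖k‖ * ρ :=
      (ContinuousLinearMap.le_opNorm _ _).trans (by gcongr)
    have h2 := hsD k
    nlinarith
  have hb : ‖A x k‖ ≤ M * ‖k‖ := ((A x).le_opNorm k).trans (by gcongr; exact hAM x hxb)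
  -- Flatness exchanges `D d k` for `D k d` plus a commutator, which cancels every term linear in
  -- `k`.
  have key : (A x k + s • D d k) + (1 + s • A x k) * A x d
      - A y (q - p₀) * (1 + s • A x k)
      = -e - s • ((A x k + s • D k d + e) * A x k) := by
    rw [hyexp]
    have hf' : s • D d k = s • D k d + s • (A x d * A x k) - s • (A x k * A x d) := by
      rw [← smul_add, ← hf, smul_add]; abel
    rw [hf']
    simp only [mul_add, add_mul, one_mul, mul_one, mul_smul_comm, smul_mul_assoc, smul_add]
    abel
  rw [key]
  have h3 : ‖A x k + s • D k d + e‖ ≤ (M + N * ρ + (K * ρ + N) * (2 * ρ)) * ‖k‖ := by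
    refine (norm_add₃_le).trans ?_
    have h4 : ‖s • D k d‖ ≤ N * ‖k‖ * ρ := (hsD d).trans (by gcongr)
    have h5 : ‖e‖ ≤ (K * ρ + N) * (‖k‖ * (2 * ρ)) := by
      refine he1.trans ?_
      rw [pow_two]
      gcongr
    nlinarith
  have h6 : ‖s • ((A x k + s • D k d + e) * A x k)‖
      ≤ ((M + N * ρ + (K * ρ + N) * (2 * ρ)) * ‖k‖) * (M * ‖k‖) := by
    rw [norm_smul]
    refine (mul_le_of_le_one_left (norm_nonneg _) hs0).trans ((norm_mul_le _ _).trans ?_)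
    gcongr
  refine (norm_sub_le _ _).trans ?_
  rw [norm_neg]
  nlinarith

theorem IsTransport.hasDerivWithinAt_one_add_smul_mul {A : E → E →L[ℝ] R} {p₀ : E} {ρ : ℝ}
    (hdiff : ∀ p ∈ ball p₀ ρ, DifferentiableAt ℝ A p) {p : E} (hp : p ∈ ball p₀ ρ) {α : ℝ → R}
    (hα : IsTransport A p₀ p α) (k : E) {s : ℝ} (hs : s ∈ Icc (0 : ℝ) 1) :
    HasDerivWithinAt (fun s : ℝ => (1 + s • A (p₀ + s • (p - p₀)) k) * α s)
      ((A (p₀ + s • (p - p₀)) k + s • fderiv ℝ A (p₀ + s • (p - p₀)) (p - p₀) k) * α s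
        + (1 + s • A (p₀ + s • (p - p₀)) k) * (A (p₀ + s • (p - p₀)) (p - p₀) * α s))
      (Icc 0 1) s := by
  have hγd : HasDerivAt (fun s : ℝ => p₀ + s • (p - p₀)) (p - p₀) s :=
    (((hasDerivAt_id s).smul_const (p - p₀)).const_add p₀).congr_deriv (one_smul ℝ _)
  have hAd : HasDerivAt (fun s : ℝ => A (p₀ + s • (p - p₀)))
      (fderiv ℝ A (p₀ + s • (p - p₀)) (p - p₀)) s :=
    (hdiff _ (add_smul_mem_ball hp hs)).hasFDerivAt.comp_hasDerivAt s hγd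
  have hAk : HasDerivAt (fun s : ℝ => A (p₀ + s • (p - p₀)) k)
      (fderiv ℝ A (p₀ + s • (p - p₀)) (p - p₀) k) s :=
    (ContinuousLinearMap.apply ℝ R k).hasFDerivAt.comp_hasDerivAt s hAd
  have h1 : HasDerivAt (fun s : ℝ => 1 + s • A (p₀ + s • (p - p₀)) k)
      (A (p₀ + s • (p - p₀)) k + s • fderiv ℝ A (p₀ + s • (p - p₀)) (p - p₀) k) s :=
    (((hasDerivAt_id s).fun_smul hAk).const_add 1).congr_deriv (by simp [add_comm])
  exact h1.hasDerivWithinAt.mul (hα.2 s hs)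

/-- Grönwall's inequality compares the transport `β` towards `q` with the approximate solution `(1 +
s A(q - p)) α`, which has the same initial value. The quadratic estimate at `s = 1` makes the
endpoint map differentiable at `p`, with derivative `k ↦ A p k * α 1`. -/
theorem IsTransport.exists_norm_sub_le {A : E → E →L[ℝ] R} {p₀ : E} {ρ M N K : ℝ} (hM : 0 ≤ M)
    (hN : 0 ≤ N) (hK : 0 ≤ K) (hMρ : M * ρ ≤ 1)
    (hdiff : ∀ p ∈ ball p₀ ρ, DifferentiableAt ℝ A p)
    (hAM : ∀ p ∈ ball p₀ ρ, ‖A p‖ ≤ M) (hDN : ∀ p ∈ ball p₀ ρ, ‖fderiv ℝ A p‖ ≤ N)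
    (hDK : ∀ p ∈ ball p₀ ρ, ∀ q ∈ ball p₀ ρ, ‖fderiv ℝ A q - fderiv ℝ A p‖ ≤ K * ‖q - p‖)
    (hflat : ∀ p ∈ ball p₀ ρ, IsFlatAt A p) {p : E} (hp : p ∈ ball p₀ ρ) {α : ℝ → R}
    (hα : IsTransport A p₀ p α) :
    ∃ C, ∀ q ∈ ball p₀ ρ, ∀ β, IsTransport A p₀ q β →
      ‖β 1 - (1 + A p (q - p)) * α 1‖ ≤ C * ‖q - p‖ ^ 2 := by
  have hαc : ContinuousOn α (Icc 0 1) := fun s hs => (hα.2 s hs).continuousWithinAt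
  obtain ⟨B, hB⟩ := isCompact_Icc.exists_bound_of_continuousOn hαc
  have hρ : 0 < ρ := pos_of_mem_ball hp
  set C₀ := ((K * ρ + N) + (M + N * ρ + (K * ρ + N) * (2 * ρ)) * M) with hC₀
  have hC₀0 : 0 ≤ C₀ := by positivity
  -- `C₀` bounds the residual and `B` bounds `α`; `exp 1 - 1` is the Grönwall factor at time `1` for
  -- Lipschitz constant `1` and zero initial error.
  refine ⟨C₀ * B * (Real.exp 1 - 1), fun q hq β hβ => ?_⟩
  set γ : ℝ → E := fun s => p₀ + s • (p - p₀) with hγ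
  set Z : ℝ → R := fun s => (1 + s • A (γ s) (q - p)) * α s with hZ
  set Z' : ℝ → R := fun s => (A (γ s) (q - p) + s • fderiv ℝ A (γ s) (p - p₀) (q - p)) * α s
    + (1 + s • A (γ s) (q - p)) * (A (γ s) (p - p₀) * α s) with hZ'
  have hZd : ∀ s ∈ Icc (0 : ℝ) 1, HasDerivWithinAt Z (Z' s) (Icc 0 1) s := fun s hs => by
    exact hα.hasDerivWithinAt_one_add_smul_mul hdiff hp _ hs
  have hIci : ∀ s ∈ Ico (0 : ℝ) 1, Icc (0 : ℝ) 1 ∈ 𝓝[Ici s] s := fun s hs =>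
    Icc_mem_nhdsGE_of_mem hs
  have hnorm : ∀ s ∈ Icc (0 : ℝ) 1, ‖A (p₀ + s • (q - p₀)) (q - p₀)‖ ≤ 1 := fun s hs => by
    refine (ContinuousLinearMap.le_opNorm _ _).trans (le_trans ?_ hMρ)
    have : ‖q - p₀‖ ≤ ρ := by rw [mem_ball, dist_eq_norm] at hq; exact hq.le
    gcongr
    exact hAM _ (add_smul_mem_ball hq hs)
  have hgron := dist_le_of_approx_trajectories_ODE_of_mem (K := 1)
    (v := fun s y => A (p₀ + s • (q - p₀)) (q - p₀) * y) (s := fun _ => univ) (f := β)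
    (f' := fun s => A (p₀ + s • (q - p₀)) (q - p₀) * β s) (g := Z) (g' := Z') (a := 0) (b := 1)
    (εf := 0) (εg := C₀ * B * ‖q - p‖ ^ 2) (δ := 0)
    (fun s hs => by
      apply LipschitzWith.lipschitzOnWith
      refine LipschitzWith.of_dist_le_mul fun x y => ?_
      rw [dist_eq_norm, dist_eq_norm, ← mul_sub]
      exact (norm_mul_le _ _).trans (mul_le_mul_of_nonneg_right
        (by simpa using hnorm s (Ico_subset_Icc_self hs)) (norm_nonneg _)))
    (fun s hs => (hβ.2 s hs).continuousWithinAt)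
    (fun s hs => (hβ.2 s (Ico_subset_Icc_self hs)).mono_of_mem_nhdsWithin (hIci s hs))
    (fun s _ => by simp) (fun _ _ => mem_univ _)
    (fun s hs => (hZd s hs).continuousWithinAt)
    (fun s hs => (hZd s (Ico_subset_Icc_self hs)).mono_of_mem_nhdsWithin (hIci s hs))
    (fun s hs => by
      have hs' := Ico_subset_Icc_self hs
      have hres := transport_residual_bound hM hN hK hdiff hAM hDN hDK hflat hp hq hs'
      rw [dist_eq_norm]
      have : Z' s - A (p₀ + s • (q - p₀)) (q - p₀) * Z s =
        ((A (γ s) (q - p) + s • fderiv ℝ A (γ s) (p - p₀) (q - p))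
          + (1 + s • A (γ s) (q - p)) * A (γ s) (p - p₀)
          - A (p₀ + s • (q - p₀)) (q - p₀) * (1 + s • A (γ s) (q - p))) * α s := by
        simp only [hZ, hZ', sub_mul, add_mul, mul_assoc]
      rw [this]
      refine (norm_mul_le _ _).trans ?_
      calc _ ≤ (C₀ * ‖q - p‖ ^ 2) * B := by
            gcongr
            exact hB s hs'
        _ = _ := by ring)
    (fun _ _ => mem_univ _) (by simp [hZ, hα.1, hβ.1]) 1 (by simp)
  rw [dist_eq_norm] at hgron
  have hZ1 : Z 1 = (1 + A p (q - p)) * α 1 := by simp [hZ, hγ]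
  rw [hZ1, gronwallBound_of_K_ne_0 (by simp)] at hgron
  refine hgron.trans (le_of_eq ?_)
  simp
  ring

theorem exists_isTransport [CompleteSpace R] {A : E → E →L[ℝ] R} {p₀ : E} {ρ M : ℝ}
    (hM : 0 ≤ M) (hMρ : M * ρ * (‖(1 : R)‖ + 1) ≤ 1) (hc : ContinuousOn A (ball p₀ ρ))
    (hAM : ∀ p ∈ ball p₀ ρ, ‖A p‖ ≤ M) {p : E} (hp : p ∈ ball p₀ ρ) :
    ∃ α, IsTransport A p₀ p α := by
  apply exists_hasDerivWithinAt_mul_of_small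
  · refine ContinuousOn.clm_apply (hc.comp (by fun_prop) fun s hs => add_smul_mem_ball hp hs)
      continuousOn_const
  · intro s hs
    refine le_trans ?_ hMρ
    gcongr
    refine (ContinuousLinearMap.le_opNorm _ _).trans ?_
    have : ‖p - p₀‖ ≤ ρ := by rw [mem_ball, dist_eq_norm] at hp; exact hp.le
    gcongr
    exact hAM _ (add_smul_mem_ball hp hs)

/-- A flat connection has a parallel frame near every point. -/
theorem exists_local_flat_frame [CompleteSpace R] {A : E → E →L[ℝ] R} {p₀ : E}
    (hA : ContDiffAt ℝ 2 A p₀) (hflat : ∀ᶠ p in 𝓝 p₀, IsFlatAt A p) :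
    ∃ Φ : E → R, Φ p₀ = 1 ∧ ∀ᶠ p in 𝓝 p₀, HasFDerivAt Φ (mulRight (A p) (Φ p)) p := by
  have hD : ContDiffAt ℝ 1 (fderiv ℝ A) p₀ := hA.fderiv_right (by norm_num)
  obtain ⟨K, t, ht, hK⟩ := hD.exists_lipschitzOnWith
  have hdiff : ∀ᶠ p in 𝓝 p₀, DifferentiableAt ℝ A p := by
    filter_upwards [hA.eventually (by simp)] with p hp using hp.differentiableAt (by simp)
  have hAM : ∀ᶠ p in 𝓝 p₀, ‖A p‖ < ‖A p₀‖ + 1 :=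
    hA.continuousAt.norm.eventually_lt_const (by linarith)
  have hDc : ContinuousAt (fun p => ‖fderiv ℝ A p‖) p₀ :=
    (continuous_norm (E := E →L[ℝ] E →L[ℝ] R)).continuousAt.comp (f := fderiv ℝ A) (x := p₀)
      hD.continuousAt
  have hDN : ∀ᶠ p in 𝓝 p₀, ‖fderiv ℝ A p‖ < ‖fderiv ℝ A p₀‖ + 1 :=
    hDc.eventually_lt_const (by linarith)
  obtain ⟨r, hr, hball⟩ := Metric.eventually_nhds_iff_ball.1
    (((hdiff.and hAM).and (hDN.and hflat)).and ht)
  set M := ‖A p₀‖ + 1 with hMdef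
  have hM : 0 < M := by positivity
  -- Small enough for the transport equation to be solvable on all of `[0, 1]` with Lipschitz
  -- constant at most `1`.
  set ρ := min r (M * (‖(1 : R)‖ + 1))⁻¹ with hρdef
  have hρ : 0 < ρ := lt_min hr (by positivity)
  have hsub : ball p₀ ρ ⊆ ball p₀ r := ball_subset_ball (min_le_left _ _)
  have hMρ : M * ρ * (‖(1 : R)‖ + 1) ≤ 1 := by
    calc M * ρ * (‖(1 : R)‖ + 1) = ρ * (M * (‖(1 : R)‖ + 1)) := by ring
      _ ≤ (M * (‖(1 : R)‖ + 1))⁻¹ * (M * (‖(1 : R)‖ + 1)) := by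
        gcongr
        exact min_le_right _ _
      _ = 1 := inv_mul_cancel₀ (by positivity)
  have hMρ' : M * ρ ≤ 1 := by
    nlinarith [mul_nonneg (mul_pos hM hρ).le (norm_nonneg (1 : R))]
  have hdiff' : ∀ p ∈ ball p₀ ρ, DifferentiableAt ℝ A p := fun p hp => (hball p (hsub hp)).1.1.1
  have hAM' : ∀ p ∈ ball p₀ ρ, ‖A p‖ ≤ M := fun p hp => (hball p (hsub hp)).1.1.2.le
  have hex : ∀ p ∈ ball p₀ ρ, ∃ α, IsTransport A p₀ p α := fun p hp =>
    exists_isTransport hM.le hMρ (fun p hp => (hdiff' p hp).continuousAt.continuousWithinAt)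
      hAM' hp
  choose! α hα using hex
  have hmem : p₀ ∈ ball p₀ ρ := mem_ball_self hρ
  have hest : ∀ p ∈ ball p₀ ρ, ∃ C, ∀ q ∈ ball p₀ ρ,
      ‖α q 1 - (1 + A p (q - p)) * α p 1‖ ≤ C * ‖q - p‖ ^ 2 := fun p hp => by
    obtain ⟨C, hC⟩ := (hα p hp).exists_norm_sub_le hM.le
      (by positivity : 0 ≤ ‖fderiv ℝ A p₀‖ + 1) K.2 hMρ' hdiff' hAM'
      (fun p hp => (hball p (hsub hp)).1.2.1.le)
      (fun p hp q hq => by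
        simpa [dist_eq_norm] using hK.dist_le_mul _ (hball q (hsub hq)).2 _ (hball p (hsub hp)).2)
      (fun p hp => (hball p (hsub hp)).1.2.2) hp
    exact ⟨C, fun q hq => hC q hq _ (hα q hq)⟩
  have hd : ∀ p ∈ ball p₀ ρ, HasFDerivAt (fun q => α q 1) (mulRight (A p) (α p 1)) p :=
    fun p hp => by
    obtain ⟨C, hC⟩ := hest p hp
    rw [hasFDerivAt_iff_isLittleO]
    refine Asymptotics.IsBigO.trans_isLittleO (g := fun q => ‖q - p‖ ^ 2)
      (Asymptotics.IsBigO.of_bound C ?_) ?_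
    · filter_upwards [isOpen_ball.mem_nhds hp] with q hq
      have := hC q hq
      rw [add_mul, one_mul, ← sub_sub] at this
      rw [norm_pow, norm_norm]
      exact this
    · exact Asymptotics.isLittleO_pow_sub_sub p one_lt_two
  refine ⟨fun p => α p 1, ?_, Filter.eventually_of_mem (isOpen_ball.mem_nhds hmem) hd⟩
  have h0 := hα p₀ hmem
  -- Transport from `p₀` to itself has zero velocity, so it stays at `1`.
  have hconst := constant_of_has_deriv_right_zero (f := α p₀) (a := 0) (b := 1)
    (fun s hs => (h0.2 s hs).continuousWithinAt)
    (fun s hs => by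
      have := (h0.2 s (Ico_subset_Icc_self hs)).mono_of_mem_nhdsWithin
        (Icc_mem_nhdsGE_of_mem hs)
      simpa using this)
  simpa [h0.1] using hconst 1 (by simp)

/-- A parallel frame of a smooth connection is smooth. -/
theorem contDiffOn_of_hasFDerivAt_mulRight {A : E → E →L[ℝ] R} {U : Set E} (hU : IsOpen U)
    (hA : ContDiffOn ℝ ∞ A U) {Φ : E → R}
    (hΦ : ∀ p ∈ U, HasFDerivAt Φ (mulRight (A p) (Φ p)) p) : ContDiffOn ℝ ∞ Φ U := by
  rw [contDiffOn_infty]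
  intro n
  -- Bootstrapping: the equation expresses the derivative of `Φ` through `A` and `Φ`, so each step
  -- gains one order.
  induction n with
  | zero => exact contDiffOn_zero.2 fun p hp => (hΦ p hp).continuousAt.continuousWithinAt
  | succ n ih =>
    push_cast
    rw [contDiffOn_succ_iff_fderiv_of_isOpen hU]
    refine ⟨fun p hp => (hΦ p hp).differentiableAt.differentiableWithinAt, by simp, ?_⟩
    have : ContDiffOn ℝ n (fun p => mulRight (A p) (Φ p)) U := by
      unfold mulRight
      refine ContDiffOn.clm_comp ?_ (hA.of_le (by exact_mod_cast le_top))
      exact (ContinuousLinearMap.contDiff _).comp_contDiffOn ih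
    exact this.congr fun p hp => (hΦ p hp).fderiv

/-- Two invertible parallel frames differ locally by a constant right factor. -/
theorem eventually_inv_mul_eq {A : E → E →L[ℝ] R} {Φ Ψ : E → R} {p₀ : E} [CompleteSpace R]
    (hΦ : ∀ᶠ p in 𝓝 p₀, HasFDerivAt Φ (mulRight (A p) (Φ p)) p)
    (hΨ : ∀ᶠ p in 𝓝 p₀, HasFDerivAt Ψ (mulRight (A p) (Ψ p)) p) (hu : IsUnit (Ψ p₀)) :
    ∀ᶠ p in 𝓝 p₀, Ring.inverse (Ψ p) * Φ p = Ring.inverse (Ψ p₀) * Φ p₀ := by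
  have hu' : ∀ᶠ p in 𝓝 p₀, IsUnit (Ψ p) :=
    hΨ.self_of_nhds.continuousAt.eventually (Units.isOpen.mem_nhds hu)
  obtain ⟨r, hr, hball⟩ := Metric.eventually_nhds_iff_ball.1 ((hΦ.and hΨ).and hu')
  -- The derivative is `-Ψ⁻¹ (A Ψ) Ψ⁻¹ Φ + Ψ⁻¹ (A Φ) = 0`.
  have hd : ∀ p ∈ ball p₀ r, HasFDerivAt (fun p => Ring.inverse (Ψ p) * Φ p)
      (0 : E →L[ℝ] R) p := fun p hp => by
    obtain ⟨⟨h1, h2⟩, u, hu⟩ := hball p hp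
    have h3 := hasFDerivAt_ringInverse (𝕜 := ℝ) u
    rw [hu] at h3
    refine ((h3.comp p h2).mul' h1).congr_fderiv ?_
    ext k
    simp [← hu, mul_assoc]
  filter_upwards [isOpen_ball.mem_nhds (mem_ball_self hr)] with p hp
  exact (convex_ball p₀ r).is_const_of_fderivWithin_eq_zero (𝕜 := ℝ)
    (fun p hp => (hd p hp).differentiableAt.differentiableWithinAt)
    (fun p hp => by
      rw [fderivWithin_of_isOpen isOpen_ball hp, (hd p hp).fderiv]) hp (mem_ball_self hr)

/-- A smooth flat connection on a simply connected open set has a global parallel frame. -/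
theorem exists_flat_frame [CompleteSpace R] {A : E → E →L[ℝ] R} {U : Set E} (hU : IsOpen U)
    (hUs : IsSimplyConnected U) (hA : ContDiffOn ℝ ∞ A U) (hflat : ∀ p ∈ U, IsFlatAt A p) :
    ∃ Φ : E → R, ∀ p ∈ U, IsUnit (Φ p) ∧ HasFDerivAt Φ (mulRight (A p) (Φ p)) p := by
  have hloc : ∀ i : U, ∃ Φ : E → R, ∃ r > 0, ∀ p ∈ ball (i : E) r,
      IsUnit (Φ p) ∧ HasFDerivAt Φ (mulRight (A p) (Φ p)) p := by
    rintro ⟨i, hi⟩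
    have hUi := hU.mem_nhds hi
    obtain ⟨Φ, h1, h2⟩ := exists_local_flat_frame ((hA.contDiffAt hUi).of_le (by norm_cast))
      (Filter.eventually_of_mem hUi hflat)
    have hu : ∀ᶠ p in 𝓝 i, IsUnit (Φ p) :=
      h2.self_of_nhds.continuousAt.eventually (Units.isOpen.mem_nhds (h1 ▸ isUnit_one))
    exact ⟨Φ, Metric.eventually_nhds_iff_ball.1 (hu.and h2)⟩
  choose Φ r hr hΦ using hloc
  have := hUs.simplyConnectedSpace
  have := hU.locallyPathConnectedSpace
  classical
  -- Gluing needs values in a group; the default `1` is taken only off the balls where the frames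
  -- are known to be invertible.
  let φ : U → U → Rˣ := fun i p => if h : IsUnit (Φ i p) then h.unit else 1
  have hφ : ∀ i p : U, (p : E) ∈ ball (i : E) (r i) → (φ i p : R) = Φ i p := fun i p hp => by
    simp [φ, (hΦ i p hp).1]
  have hφi : ∀ i p : U, (p : E) ∈ ball (i : E) (r i) →
      (((φ i p)⁻¹ : Rˣ) : R) = Ring.inverse (Φ i p) := fun i p hp => by
    rw [← hφ i p hp, Ring.inverse_unit]
  have hVo : ∀ i : U, IsOpen {p : U | (p : E) ∈ ball (i : E) (r i)} := fun i =>
    isOpen_ball.preimage continuous_subtype_val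
  obtain ⟨ψ, hψ⟩ := exists_global_section (fun i : U => {p : U | (p : E) ∈ ball (i : E) (r i)})
    hVo (fun i => mem_ball_self (hr i)) φ (by
      rintro i j x ⟨hi, hj⟩
      have h1 := eventually_inv_mul_eq (A := A) (Φ := Φ i) (Ψ := Φ j)
        (Filter.eventually_of_mem (isOpen_ball.mem_nhds hi)
          fun p hp => (hΦ i p hp).2)
        (Filter.eventually_of_mem (isOpen_ball.mem_nhds hj)
          fun p hp => (hΦ j p hp).2) (hΦ j x hj).1
      filter_upwards [continuous_subtype_val.continuousAt.eventually h1, (hVo i).mem_nhds hi,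
        (hVo j).mem_nhds hj] with y hy hyi hyj
      ext
      rw [Units.val_mul, Units.val_mul, hφi j y hyj, hφi j x hj, hφ i y hyi, hφ i x hi, hy])
  refine ⟨fun p => if h : p ∈ U then ψ ⟨p, h⟩ else 0, fun p hp => ⟨by simp [hp], ?_⟩⟩
  obtain ⟨c, hc⟩ := hψ ⟨p, hp⟩
  have hev : (fun p => if h : p ∈ U then (ψ ⟨p, h⟩ : R) else 0) =ᶠ[𝓝 p]
      fun q => Φ ⟨p, hp⟩ q * c := by
    have h1 : ∀ᶠ q in 𝓝 p, ∀ h : q ∈ U, ψ ⟨q, h⟩ = φ ⟨p, hp⟩ ⟨q, h⟩ * c := by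
      rw [nhds_subtype_eq_comap, Filter.eventually_comap] at hc
      exact hc.mono fun q hq h => hq ⟨q, h⟩ rfl
    filter_upwards [h1, hU.mem_nhds hp, isOpen_ball.mem_nhds (mem_ball_self (hr ⟨p, hp⟩))]
      with q hq hqU hqb
    simp only [hqU, dif_pos]
    rw [hq hqU, Units.val_mul, hφ ⟨p, hp⟩ ⟨q, hqU⟩ hqb]
  refine HasFDerivAt.congr_of_eventuallyEq ?_ hev
  have hevp := hev.eq_of_nhds
  simp only at hevp ⊢
  rw [hevp]
  -- `A` acts from the left, so a constant right factor preserves parallelism.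
  refine ((hΦ ⟨p, hp⟩ p (mem_ball_self (hr _))).2.mul_const' (c : R)).congr_fderiv ?_
  ext k
  simp [mul_assoc]

end Flat

/-! ### Calculus of the partial derivatives and of the heat operator -/

section PartialDerivatives

variable {U : Set (ℝ × ℝ)} {f g : ℝ × ℝ → ℝ} {p : ℝ × ℝ}

theorem hasDerivAt_fst_slice (hf : DifferentiableAt ℝ f p) :
    HasDerivAt (fun t => f (t, p.2)) (fderiv ℝ f p (1, 0)) p.1 :=
  HasFDerivAt.comp_hasDerivAt (f := fun t : ℝ => (t, p.2)) p.1 hf.hasFDerivAt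
    ((hasDerivAt_id p.1).prodMk (hasDerivAt_const _ _))

theorem hasDerivAt_snd_slice (hf : DifferentiableAt ℝ f p) :
    HasDerivAt (fun x => f (p.1, x)) (fderiv ℝ f p (0, 1)) p.2 :=
  HasFDerivAt.comp_hasDerivAt (f := fun x : ℝ => (p.1, x)) p.2 hf.hasFDerivAt
    ((hasDerivAt_const _ _).prodMk (hasDerivAt_id p.2))

theorem Dt_eq_fderiv (hf : DifferentiableAt ℝ f p) : Dt f p = fderiv ℝ f p (1, 0) :=
  (hasDerivAt_fst_slice hf).deriv

theorem Dx_eq_fderiv (hf : DifferentiableAt ℝ f p) : Dx f p = fderiv ℝ f p (0, 1) :=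
  (hasDerivAt_snd_slice hf).deriv

theorem hasDerivAt_Dx (hf : DifferentiableAt ℝ f p) :
    HasDerivAt (fun x => f (p.1, x)) (Dx f p) p.2 :=
  Dx_eq_fderiv hf ▸ hasDerivAt_snd_slice hf

theorem ContDiffOn.differentiableAt_of_isOpen (hf : ContDiffOn ℝ ∞ f U) (hU : IsOpen U)
    (hp : p ∈ U) : DifferentiableAt ℝ f p :=
  (hf.contDiffAt (hU.mem_nhds hp)).differentiableAt (by simp)

theorem ContDiffOn.fderiv_apply_of_isOpen (hf : ContDiffOn ℝ ∞ f U) (hU : IsOpen U) (w : ℝ × ℝ) :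
    ContDiffOn ℝ ∞ (fun p => fderiv ℝ f p w) U :=
  (hf.fderiv_of_isOpen hU (by simp)).clm_apply contDiffOn_const

theorem ContDiffOn.Dx (hf : ContDiffOn ℝ ∞ f U) (hU : IsOpen U) : ContDiffOn ℝ ∞ (Dx f) U :=
  (hf.fderiv_apply_of_isOpen hU (0, 1)).congr fun _ hp =>
    Dx_eq_fderiv (hf.differentiableAt_of_isOpen hU hp)

theorem ContDiffOn.Dt (hf : ContDiffOn ℝ ∞ f U) (hU : IsOpen U) : ContDiffOn ℝ ∞ (Dt f) U :=
  (hf.fderiv_apply_of_isOpen hU (1, 0)).congr fun _ hp =>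
    Dt_eq_fderiv (hf.differentiableAt_of_isOpen hU hp)

theorem Dx_congr (hU : IsOpen U) (h : Set.EqOn f g U) : Set.EqOn (Dx f) (Dx g) U := by
  intro p hp
  apply Filter.EventuallyEq.deriv_eq
  have : Continuous fun x : ℝ => (p.1, x) := by fun_prop
  filter_upwards [(hU.preimage this).mem_nhds hp] with x hx using h hx

theorem Dt_congr (hU : IsOpen U) (h : Set.EqOn f g U) : Set.EqOn (Dt f) (Dt g) U := by
  intro p hp
  apply Filter.EventuallyEq.deriv_eq
  have : Continuous fun t : ℝ => (t, p.2) := by fun_prop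
  filter_upwards [(hU.preimage this).mem_nhds hp] with x hx using h hx

theorem Dx_add (hf : DifferentiableAt ℝ f p) (hg : DifferentiableAt ℝ g p) :
    Dx (f + g) p = Dx f p + Dx g p := by
  rw [Dx_eq_fderiv hf, Dx_eq_fderiv hg, Dx_eq_fderiv (hf.add hg), fderiv_add hf hg]
  rfl

theorem Dt_add (hf : DifferentiableAt ℝ f p) (hg : DifferentiableAt ℝ g p) :
    Dt (f + g) p = Dt f p + Dt g p := by
  rw [Dt_eq_fderiv hf, Dt_eq_fderiv hg, Dt_eq_fderiv (hf.add hg), fderiv_add hf hg]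
  rfl

theorem Dx_mul (hf : DifferentiableAt ℝ f p) (hg : DifferentiableAt ℝ g p) :
    Dx (f * g) p = Dx f p * g p + f p * Dx g p := by
  rw [Dx_eq_fderiv hf, Dx_eq_fderiv hg, Dx_eq_fderiv (hf.mul hg), fderiv_mul hf hg]
  simp
  ring

theorem Dt_mul (hf : DifferentiableAt ℝ f p) (hg : DifferentiableAt ℝ g p) :
    Dt (f * g) p = Dt f p * g p + f p * Dt g p := by
  rw [Dt_eq_fderiv hf, Dt_eq_fderiv hg, Dt_eq_fderiv (hf.mul hg), fderiv_mul hf hg]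
  simp
  ring

theorem Dx_const_mul (c : ℝ) (f : ℝ × ℝ → ℝ) (p : ℝ × ℝ) :
    Dx (fun q => c * f q) p = c * Dx f p :=
  deriv_const_mul_field c

theorem Dt_const_mul (c : ℝ) (f : ℝ × ℝ → ℝ) (p : ℝ × ℝ) :
    Dt (fun q => c * f q) p = c * Dt f p :=
  deriv_const_mul_field c

theorem Dt_Dx_comm (hU : IsOpen U) (hf : ContDiffOn ℝ ∞ f U) (hp : p ∈ U) :
    Dt (Dx f) p = Dx (Dt f) p := by
  have hd : DifferentiableAt ℝ (fderiv ℝ f) p :=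
    ((hf.fderiv_of_isOpen hU (m := ∞) (by simp)).contDiffAt
      (hU.mem_nhds hp)).differentiableAt (by simp)
  have h1 : ∀ w : ℝ × ℝ, DifferentiableAt ℝ (fun q => fderiv ℝ f q w) p := fun w =>
    hd.clm_apply (differentiableAt_const w)
  have h2 : ∀ w z : ℝ × ℝ, fderiv ℝ (fun q => fderiv ℝ f q w) p z =
      fderiv ℝ (fderiv ℝ f) p z w := fun w z => by
    rw [fderiv_clm_apply hd (differentiableAt_const w)]
    simp
  rw [Dt_congr hU (fun q hq => Dx_eq_fderiv (hf.differentiableAt_of_isOpen hU hq)) hp,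
    Dx_congr hU (fun q hq => Dt_eq_fderiv (hf.differentiableAt_of_isOpen hU hq)) hp,
    Dt_eq_fderiv (h1 _), Dx_eq_fderiv (h1 _), h2, h2]
  exact ((hf.contDiffAt (hU.mem_nhds hp)).isSymmSndFDerivAt (by simp; norm_cast)) _ _

/-- The backward heat operator `f_t + f_xx`. -/
noncomputable def heatOp (f : ℝ × ℝ → ℝ) (p : ℝ × ℝ) : ℝ := Dt f p + Dx (Dx f) p

theorem heatOp_congr (hU : IsOpen U) (h : Set.EqOn f g U) : Set.EqOn (heatOp f) (heatOp g) U :=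
  fun _ hp => congrArg₂ (· + ·) (Dt_congr hU h hp) (Dx_congr hU (Dx_congr hU h) hp)

theorem heatOp_add (hU : IsOpen U) (hf : ContDiffOn ℝ ∞ f U) (hg : ContDiffOn ℝ ∞ g U)
    (hp : p ∈ U) : heatOp (f + g) p = heatOp f p + heatOp g p := by
  have h : Set.EqOn (Dx (f + g)) (Dx f + Dx g) U := fun q hq =>
    Dx_add (hf.differentiableAt_of_isOpen hU hq) (hg.differentiableAt_of_isOpen hU hq)
  simp only [heatOp]
  rw [Dx_congr hU h hp,
    Dx_add ((hf.Dx hU).differentiableAt_of_isOpen hU hp)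
      ((hg.Dx hU).differentiableAt_of_isOpen hU hp),
    Dt_add (hf.differentiableAt_of_isOpen hU hp) (hg.differentiableAt_of_isOpen hU hp)]
  ring

/-- The cross term `2 f_x g_x` is the source of all terms with a factor `2` in the determining
system. -/
theorem heatOp_mul (hU : IsOpen U) (hf : ContDiffOn ℝ ∞ f U) (hg : ContDiffOn ℝ ∞ g U)
    (hp : p ∈ U) :
    heatOp (f * g) p = heatOp f p * g p + f p * heatOp g p + 2 * Dx f p * Dx g p := by
  have h : Set.EqOn (Dx (f * g)) (Dx f * g + f * Dx g) U := fun q hq =>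
    Dx_mul (hf.differentiableAt_of_isOpen hU hq) (hg.differentiableAt_of_isOpen hU hq)
  have hfd := hf.differentiableAt_of_isOpen hU hp
  have hgd := hg.differentiableAt_of_isOpen hU hp
  have hfx := (hf.Dx hU).differentiableAt_of_isOpen hU hp
  have hgx := (hg.Dx hU).differentiableAt_of_isOpen hU hp
  simp only [heatOp]
  rw [Dx_congr hU h hp, Dx_add (hfx.mul hgd) (hfd.mul hgx), Dx_mul hfx hgd, Dx_mul hfd hgx,
    Dt_mul hfd hgd]
  ring

theorem heatOp_const_mul (c : ℝ) (f : ℝ × ℝ → ℝ) (p : ℝ × ℝ) :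
    heatOp (fun q => c * f q) p = c * heatOp f p := by
  have : Dx (fun q => c * f q) = fun q => c * Dx f q := funext (Dx_const_mul c f)
  simp only [heatOp]
  rw [this, Dx_const_mul, Dt_const_mul]
  ring

/-- The heat operator has constant coefficients, so it commutes with `∂_x`. -/
theorem heatOp_Dx_eq_zero (hU : IsOpen U) (hf : ContDiffOn ℝ ∞ f U)
    (h : ∀ q ∈ U, heatOp f q = 0) (hp : p ∈ U) : heatOp (Dx f) p = 0 := by
  have h1 : Set.EqOn (heatOp f) (fun _ => 0) U := h
  have h2 := Dx_congr hU h1 hp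
  have h3 : Dx (heatOp f) p = Dx (Dt f) p + Dx (Dx (Dx f)) p :=
    Dx_add ((hf.Dt hU).differentiableAt_of_isOpen hU hp)
      (((hf.Dx hU).Dx hU).differentiableAt_of_isOpen hU hp)
  have h4 : Dx (fun _ => (0 : ℝ)) p = 0 := by simp [Dx]
  rw [heatOp, Dt_Dx_comm hU hf hp, ← h3, h2, h4]

/-- The compatibility of the heat equation with a third order linear ordinary differential
equation in `x`. -/
theorem heat_compatibility {a b c y : ℝ × ℝ → ℝ} (hU : IsOpen U) (ha : ContDiffOn ℝ ∞ a U)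
    (hb : ContDiffOn ℝ ∞ b U) (hc : ContDiffOn ℝ ∞ c U) (hy : ContDiffOn ℝ ∞ y U)
    (heat : ∀ q ∈ U, heatOp y q = 0)
    (hode : ∀ q ∈ U, Dx (Dx (Dx y)) q = a q * y q + b q * Dx y q + c q * Dx (Dx y) q)
    (hp : p ∈ U) :
    (heatOp a p + 2 * Dx c p * a p) * y p
      + (heatOp b p + 2 * Dx a p + 2 * Dx c p * b p) * Dx y p
      + (heatOp c p + 2 * Dx b p + 2 * Dx c p * c p) * Dx (Dx y) p = 0 := by
  have hy1 := hy.Dx hU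
  have hy2 := hy1.Dx hU
  have e1 := fun q (hq : q ∈ U) => heatOp_Dx_eq_zero hU hy heat hq
  have e2 := fun q (hq : q ∈ U) => heatOp_Dx_eq_zero hU hy1 e1 hq
  have e3 := heatOp_Dx_eq_zero hU hy2 e2 hp
  have h : Set.EqOn (Dx (Dx (Dx y))) (a * y + b * Dx y + c * Dx (Dx y)) U := hode
  have m0 : ContDiffOn ℝ ∞ (a * y) U := ha.mul hy
  have m1 : ContDiffOn ℝ ∞ (b * Dx y) U := hb.mul hy1
  have m2 : ContDiffOn ℝ ∞ (c * Dx (Dx y)) U := hc.mul hy2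
  have m3 : ContDiffOn ℝ ∞ (a * y + b * Dx y) U := m0.add m1
  -- The heat operator kills `y_xxx` and all of `y`, `y_x`, `y_xx`; the cross term `2 c_x y_xxx` is
  -- reduced by the equation itself.
  rw [heatOp_congr hU h hp, heatOp_add hU m3 m2 hp,
    heatOp_add hU m0 m1 hp, heatOp_mul hU ha hy hp, heatOp_mul hU hb hy1 hp,
    heatOp_mul hU hc hy2 hp, heat p hp, e1 p hp, e2 p hp, hode p hp] at e3
  linear_combination e3

end PartialDerivatives

/-! ### Wronskians and the converse part -/

section Wronskian

variable {U : Set (ℝ × ℝ)} {v : Fin 3 → ℝ × ℝ → ℝ} {p : ℝ × ℝ}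

theorem det3_apply (a b c : Fin 3 → ℝ × ℝ → ℝ) (p : ℝ × ℝ) :
    det3 a b c p = a 0 p * b 1 p * c 2 p - a 0 p * c 1 p * b 2 p - b 0 p * a 1 p * c 2 p
      + b 0 p * c 1 p * a 2 p + c 0 p * a 1 p * b 2 p - c 0 p * b 1 p * a 2 p := by
  simp [det3, Matrix.det_fin_three]

theorem contDiffOn_det3 {a b c : Fin 3 → ℝ × ℝ → ℝ} (ha : ∀ i, ContDiffOn ℝ ∞ (a i) U)
    (hb : ∀ i, ContDiffOn ℝ ∞ (b i) U) (hc : ∀ i, ContDiffOn ℝ ∞ (c i) U) :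
    ContDiffOn ℝ ∞ (det3 a b c) U := by
  have h : det3 a b c = fun p => _ := funext (det3_apply a b c)
  rw [h]
  have a0 := ha 0
  have a1 := ha 1
  have a2 := ha 2
  have b0 := hb 0
  have b1 := hb 1
  have b2 := hb 2
  have c0 := hc 0
  have c1 := hc 1
  have c2 := hc 2
  fun_prop

/-- Differentiating column by column, the first two determinants have a repeated column. -/
theorem Dx_wronskian3 (hU : IsOpen U) (hv : ∀ i, ContDiffOn ℝ ∞ (v i) U) (hp : p ∈ U) :
    Dx (wronskian3 v) p = det3 v (DxT v) (DxT (DxT (DxT v))) p := by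
  have h0 := fun i => hasDerivAt_Dx ((hv i).differentiableAt_of_isOpen hU hp)
  have h1 := fun i => hasDerivAt_Dx (((hv i).Dx hU).differentiableAt_of_isOpen hU hp)
  have h2 := fun i => hasDerivAt_Dx ((((hv i).Dx hU).Dx hU).differentiableAt_of_isOpen hU hp)
  have h := (((((((h0 0).mul (h1 1)).mul (h2 2)).sub (((h0 0).mul (h2 1)).mul (h1 2))).sub
    (((h1 0).mul (h0 1)).mul (h2 2))).add (((h1 0).mul (h2 1)).mul (h0 2))).add
    (((h2 0).mul (h0 1)).mul (h1 2))).sub (((h2 0).mul (h1 1)).mul (h0 2))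
  have hw : (fun x => wronskian3 v (p.1, x)) = _ := funext fun x => det3_apply _ _ _ (p.1, x)
  rw [Dx, hw]
  refine (h.deriv).trans ?_
  simp only [det3_apply, DxT, Pi.mul_apply]
  ring

/-- Cramer's rule: the components of `v` solve a third order equation whose coefficients are
ratios of determinants. -/
theorem Dx_Dx_Dx_mul_wronskian3 (hU : IsOpen U) (hv : ∀ i, ContDiffOn ℝ ∞ (v i) U) (hp : p ∈ U)
    (i : Fin 3) :
    Dx (Dx (Dx (v i))) p * wronskian3 v p = wronskian3 (DxT v) p * v i p
      - det3 v (DxT (DxT v)) (DxT (DxT (DxT v))) p * Dx (v i) p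
      + Dx (wronskian3 v) p * Dx (Dx (v i)) p := by
  rw [Dx_wronskian3 hU hv hp]
  simp only [wronskian3, det3_apply, DxT]
  fin_cases i <;> simp only [Fin.zero_eta, Fin.mk_one, Fin.reduceFinMk] <;> ring

theorem eq_zero_of_wronskian3_ne_zero (hW : wronskian3 v p ≠ 0) {α β γ : ℝ}
    (h : ∀ i, α * v i p + β * Dx (v i) p + γ * Dx (Dx (v i)) p = 0) :
    α = 0 ∧ β = 0 ∧ γ = 0 := by
  have := Matrix.eq_zero_of_mulVec_eq_zero (v := ![α, β, γ]) hW (by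
    ext i
    simp only [Matrix.mulVec, dotProduct, Fin.sum_univ_three, DxT]
    simpa [mul_comm] using h i)
  exact ⟨congrFun this 0, congrFun this 1, congrFun this 2⟩

/-- Compatibility holds for all three components of `v` at once, so its coefficients form a vector
killed by an invertible Wronskian matrix. Up to constant factors they are the left-hand sides of the
determining equations. -/
theorem solvesDeterminingSystem_of_isRepresentedBy {ξ0 η1 η0 : ℝ × ℝ → ℝ} (hU : IsOpen U)
    (hv : IsHeatTriple U v) (hr : IsRepresentedBy U v ξ0 η1 η0) :
    SolvesDeterminingSystem U ξ0 η1 η0 := by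
  have h0 := hv.smooth
  have h1 : ∀ i, ContDiffOn ℝ ∞ (DxT v i) U := fun i => (h0 i).Dx hU
  have h2 : ∀ i, ContDiffOn ℝ ∞ (DxT (DxT v) i) U := fun i => (h1 i).Dx hU
  have h3 : ∀ i, ContDiffOn ℝ ∞ (DxT (DxT (DxT v)) i) U := fun i => (h2 i).Dx hU
  have hW : ContDiffOn ℝ ∞ (wronskian3 v) U := contDiffOn_det3 h0 h1 h2
  have hξ : ContDiffOn ℝ ∞ ξ0 U := ((hW.Dx hU).div hW hr.wronskian_ne_zero).congr hr.ξ0_eq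
  have hη1 : ContDiffOn ℝ ∞ η1 U :=
    ((contDiffOn_det3 h0 h2 h3).div hW hr.wronskian_ne_zero).congr hr.η1_eq
  have hη0 : ContDiffOn ℝ ∞ η0 U :=
    (contDiffOn_const.mul ((contDiffOn_det3 h1 h2 h3).div hW hr.wronskian_ne_zero)).congr hr.η0_eq
  have hode : ∀ i, ∀ q ∈ U, Dx (Dx (Dx (v i))) q = (-(1 / 2) * η0 q) * v i q
      + (-1 * η1 q) * Dx (v i) q + ξ0 q * Dx (Dx (v i)) q := by
    intro i q hq
    have hne := hr.wronskian_ne_zero q hq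
    rw [hr.ξ0_eq q hq, hr.η1_eq q hq, hr.η0_eq q hq]
    field_simp
    linear_combination Dx_Dx_Dx_mul_wronskian3 hU h0 hq i
  have key := fun p (hp : p ∈ U) => eq_zero_of_wronskian3_ne_zero (hr.wronskian_ne_zero p hp)
    fun i => heat_compatibility hU (contDiffOn_const.mul hη0) (contDiffOn_const.mul hη1) hξ (h0 i)
      (hv.heat i) (hode i) hp
  simp only [heatOp_const_mul, Dx_const_mul] at key
  refine ⟨hξ, hη1, hη0, fun p hp => ?_, fun p hp => ?_, fun p hp => ?_⟩ <;>
    obtain ⟨ka, kb, kc⟩ := key p hp <;> simp only [heatOp] at ka kb kc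
  · linear_combination kc
  · linear_combination -kb
  · linear_combination -2 * ka

end Wronskian

/-! ### Flat connections in the plane -/

section ConnectionForm

variable {R : Type*} [NormedRing R] [NormedAlgebra ℝ R] {A B : ℝ × ℝ → R} {U : Set (ℝ × ℝ)}
  {p : ℝ × ℝ}

/-- The one-form `B dt + A dx`. -/
noncomputable def connectionForm (A B : ℝ × ℝ → R) (p : ℝ × ℝ) : ℝ × ℝ →L[ℝ] R :=
  (ContinuousLinearMap.fst ℝ ℝ ℝ).smulRight (B p) + (ContinuousLinearMap.snd ℝ ℝ ℝ).smulRight (A p)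

theorem connectionForm_apply (A B : ℝ × ℝ → R) (p h : ℝ × ℝ) :
    connectionForm A B p h = h.1 • B p + h.2 • A p := rfl

theorem contDiffOn_connectionForm (hA : ContDiffOn ℝ ∞ A U) (hB : ContDiffOn ℝ ∞ B U) :
    ContDiffOn ℝ ∞ (connectionForm A B) U :=
  (contDiffOn_const.smulRight hB).add (contDiffOn_const.smulRight hA)

/-- Curvature is bilinear and antisymmetric, so in the plane it suffices to test it on the
coordinate directions, which gives `A_t + A B = B_x + B A`. -/
theorem isFlatAt_connectionForm (hA : DifferentiableAt ℝ A p) (hB : DifferentiableAt ℝ B p)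
    (hC : DifferentiableAt ℝ (connectionForm A B) p)
    (hAB : fderiv ℝ A p (1, 0) + A p * B p = fderiv ℝ B p (0, 1) + B p * A p) :
    IsFlatAt (connectionForm A B) p := by
  have hfd : ∀ d k : ℝ × ℝ, fderiv ℝ (connectionForm A B) p d k
      = k.1 • fderiv ℝ B p d + k.2 • fderiv ℝ A p d := fun d k => by
    have h1 : fderiv ℝ (fun q => connectionForm A B q k) p d
        = fderiv ℝ (connectionForm A B) p d k := by
      rw [fderiv_clm_apply hC (differentiableAt_const k)]
      simp
    have h2 : HasFDerivAt (fun q => connectionForm A B q k)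
        (k.1 • fderiv ℝ B p + k.2 • fderiv ℝ A p) p :=
      (hB.hasFDerivAt.const_smul k.1).add (hA.hasFDerivAt.const_smul k.2)
    rw [← h1, h2.fderiv]
    rfl
  have hsplit : ∀ (L : ℝ × ℝ →L[ℝ] R) (d : ℝ × ℝ),
      L d = d.1 • L (1, 0) + d.2 • L (0, 1) := fun L d => by
    rw [← map_smul, ← map_smul, ← map_add]
    simp
  intro d k
  rw [hfd, hfd, hsplit (fderiv ℝ A p) d, hsplit (fderiv ℝ B p) d, hsplit (fderiv ℝ A p) k,
    hsplit (fderiv ℝ B p) k]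
  simp only [connectionForm_apply, add_mul, mul_add, smul_mul_assoc, mul_smul_comm]
  have hAt : fderiv ℝ A p (1, 0) = fderiv ℝ B p (0, 1) + B p * A p - A p * B p := by
    rw [← hAB]; abel
  rw [hAt]
  module

/-- A global invertible solution of `Φ_x = A Φ`, `Φ_t = B Φ`. -/
theorem exists_fundamental_solution [CompleteSpace R] (hU : IsOpen U) (hUs : IsSimplyConnected U)
    (hA : ContDiffOn ℝ ∞ A U) (hB : ContDiffOn ℝ ∞ B U)
    (h : ∀ p ∈ U, fderiv ℝ A p (1, 0) + A p * B p = fderiv ℝ B p (0, 1) + B p * A p) :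
    ∃ Φ : ℝ × ℝ → R, ContDiffOn ℝ ∞ Φ U ∧ ∀ p ∈ U, IsUnit (Φ p) ∧ DifferentiableAt ℝ Φ p ∧
      fderiv ℝ Φ p (0, 1) = A p * Φ p ∧ fderiv ℝ Φ p (1, 0) = B p * Φ p := by
  have hC := contDiffOn_connectionForm hA hB
  obtain ⟨Φ, hΦ⟩ := exists_flat_frame hU hUs hC fun p hp =>
    isFlatAt_connectionForm ((hA.contDiffAt (hU.mem_nhds hp)).differentiableAt (by simp))
      ((hB.contDiffAt (hU.mem_nhds hp)).differentiableAt (by simp))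
      ((hC.contDiffAt (hU.mem_nhds hp)).differentiableAt (by simp)) (h p hp)
  refine ⟨Φ, contDiffOn_of_hasFDerivAt_mulRight hU hC fun p hp => (hΦ p hp).2,
    fun p hp => ⟨(hΦ p hp).1, (hΦ p hp).2.differentiableAt, ?_, ?_⟩⟩ <;>
  simp [(hΦ p hp).2.fderiv, connectionForm_apply]

end ConnectionForm

/-! ### Fundamental matrices -/

section MatrixConnection

variable {U : Set (ℝ × ℝ)} {A B : ℝ × ℝ → Matrix (Fin 3) (Fin 3) ℝ}

/-- Smoothness and derivatives are stated entrywise, so they do not depend on a norm on matrices;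
`R` serves as a normed model, and finite dimension makes the passage through `e` smooth. -/
theorem exists_fundamental_matrix_of_algEquiv {R : Type*} [NormedRing R] [NormedAlgebra ℝ R]
    (e : R ≃ₐ[ℝ] Matrix (Fin 3) (Fin 3) ℝ) (hU : IsOpen U) (hUs : IsSimplyConnected U)
    (hA : ∀ i j, ContDiffOn ℝ ∞ (fun p => A p i j) U)
    (hB : ∀ i j, ContDiffOn ℝ ∞ (fun p => B p i j) U)
    (h : ∀ p ∈ U, ∀ i j, Dt (fun q => A q i j) p + (A p * B p) i j
      = Dx (fun q => B q i j) p + (B p * A p) i j) :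
    ∃ Φ : ℝ × ℝ → Matrix (Fin 3) (Fin 3) ℝ, (∀ i j, ContDiffOn ℝ ∞ (fun p => Φ p i j) U) ∧
      ∀ p ∈ U, (Φ p).det ≠ 0 ∧ ∀ i j, Dx (fun q => Φ q i j) p = (A p * Φ p) i j ∧
        Dt (fun q => Φ q i j) p = (B p * Φ p) i j := by
  have : FiniteDimensional ℝ R := e.symm.toLinearEquiv.finiteDimensional
  have : CompleteSpace R := FiniteDimensional.complete ℝ R
  let entry (i j : Fin 3) : R →L[ℝ] ℝ :=
    LinearMap.toContinuousLinearMap (Matrix.entryLinearMap ℝ ℝ i j ∘ₗ e.toLinearMap)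
  have hentry : ∀ i j r, entry i j r = e r i j := fun _ _ _ => rfl
  have hsmooth : ∀ {F : ℝ × ℝ → Matrix (Fin 3) (Fin 3) ℝ},
      (∀ i j, ContDiffOn ℝ ∞ (fun p => F p i j) U) → ContDiffOn ℝ ∞ (fun p => e.symm (F p)) U := by
    intro F hF
    have : (fun p => e.symm (F p))
        = fun p => ∑ i, ∑ j, F p i j • e.symm (Matrix.single i j (1 : ℝ)) := by
      funext p
      conv_lhs => rw [Matrix.matrix_eq_sum_single (F p)]
      simp only [map_sum, ← map_smul, Matrix.smul_single, smul_eq_mul, mul_one]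
    rw [this]
    exact ContDiffOn.sum fun i _ => ContDiffOn.sum fun j _ => (hF i j).smul contDiffOn_const
  have hfd : ∀ {G : ℝ × ℝ → R} {p : ℝ × ℝ}, DifferentiableAt ℝ G p → ∀ i j,
      HasFDerivAt (fun q => e (G q) i j) ((entry i j).comp (fderiv ℝ G p)) p :=
    fun hG i j => (entry i j).hasFDerivAt.comp _ hG.hasFDerivAt
  have hDx : ∀ {G : ℝ × ℝ → R} {p : ℝ × ℝ}, DifferentiableAt ℝ G p → ∀ i j,
      Dx (fun q => e (G q) i j) p = e (fderiv ℝ G p (0, 1)) i j := fun hG i j => by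
    rw [Dx_eq_fderiv (hfd hG i j).differentiableAt, (hfd hG i j).fderiv]
    rfl
  have hDt : ∀ {G : ℝ × ℝ → R} {p : ℝ × ℝ}, DifferentiableAt ℝ G p → ∀ i j,
      Dt (fun q => e (G q) i j) p = e (fderiv ℝ G p (1, 0)) i j := fun hG i j => by
    rw [Dt_eq_fderiv (hfd hG i j).differentiableAt, (hfd hG i j).fderiv]
    rfl
  have hA' := hsmooth hA
  have hB' := hsmooth hB
  obtain ⟨Φ, hs, hΦ⟩ := exists_fundamental_solution hU hUs hA' hB' (fun p hp => by
    apply e.injective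
    ext i j
    have hp' := h p hp i j
    have h1 := hDt ((hA'.contDiffAt (hU.mem_nhds hp)).differentiableAt (by simp)) i j
    have h2 := hDx ((hB'.contDiffAt (hU.mem_nhds hp)).differentiableAt (by simp)) i j
    simp only [AlgEquiv.apply_symm_apply] at h1 h2
    simp only [map_add, map_mul, AlgEquiv.apply_symm_apply, Matrix.add_apply]
    rw [← h1, ← h2, hp'])
  refine ⟨fun p => e (Φ p), fun i j => (entry i j).contDiff.comp_contDiffOn hs,
    fun p hp => ⟨?_, fun i j => ?_⟩⟩
  · exact ((Matrix.isUnit_iff_isUnit_det _).1 ((hΦ p hp).1.map e)).ne_zero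
  · obtain ⟨-, hd, hx, ht⟩ := hΦ p hp
    rw [hDx hd, hDt hd, hx, ht, map_mul, map_mul, AlgEquiv.apply_symm_apply,
      AlgEquiv.apply_symm_apply]
    exact ⟨rfl, rfl⟩

/-- A global fundamental matrix of `Φ_x = A Φ`, `Φ_t = B Φ`. -/
theorem exists_fundamental_matrix (hU : IsOpen U) (hUs : IsSimplyConnected U)
    (hA : ∀ i j, ContDiffOn ℝ ∞ (fun p => A p i j) U)
    (hB : ∀ i j, ContDiffOn ℝ ∞ (fun p => B p i j) U)
    (h : ∀ p ∈ U, ∀ i j, Dt (fun q => A q i j) p + (A p * B p) i j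
      = Dx (fun q => B q i j) p + (B p * A p) i j) :
    ∃ Φ : ℝ × ℝ → Matrix (Fin 3) (Fin 3) ℝ, (∀ i j, ContDiffOn ℝ ∞ (fun p => Φ p i j) U) ∧
      ∀ p ∈ U, (Φ p).det ≠ 0 ∧ ∀ i j, Dx (fun q => Φ q i j) p = (A p * Φ p) i j ∧
        Dt (fun q => Φ q i j) p = (B p * Φ p) i j :=
  letI := Matrix.linftyOpNormedRing (n := Fin 3) (α := ℝ)
  letI := Matrix.linftyOpNormedAlgebra (n := Fin 3) (R := ℝ) (α := ℝ)
  exists_fundamental_matrix_of_algEquiv AlgEquiv.refl hU hUs hA hB h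

end MatrixConnection

/-! ### The compatible system and the direct part -/

section Representation

variable {U : Set (ℝ × ℝ)} {ξ0 η1 η0 : ℝ × ℝ → ℝ}

theorem SolvesDeterminingSystem.mono {Ω : Set (ℝ × ℝ)} (h : SolvesDeterminingSystem Ω ξ0 η1 η0)
    (hU : U ⊆ Ω) : SolvesDeterminingSystem U ξ0 η1 η0 :=
  ⟨h.smooth_ξ0.mono hU, h.smooth_η1.mono hU, h.smooth_η0.mono hU, fun p hp => h.eq1 p (hU hp),
    fun p hp => h.eq2 p (hU hp), fun p hp => h.eq3 p (hU hp)⟩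

/-- The matrix of the first order system equivalent to `y_xxx = a y + b y_x + c y_xx`. -/
def companionMatrix (a b c : ℝ × ℝ → ℝ) (p : ℝ × ℝ) : Matrix (Fin 3) (Fin 3) ℝ :=
  !![0, 1, 0; 0, 0, 1; a p, b p, c p]

/-- The matrix of the `t`-evolution of `(y, y_x, y_xx)` for solutions of the heat equation with
`y_xxx = a y + b y_x + c y_xx`. -/
noncomputable def evolutionMatrix (a b c : ℝ × ℝ → ℝ) (p : ℝ × ℝ) : Matrix (Fin 3) (Fin 3) ℝ :=
  !![0, 0, -1;
    -a p, -b p, -c p;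
    -(Dx a p + c p * a p), -(Dx b p + a p + c p * b p), -(Dx c p + b p + c p * c p)]

theorem Dx_neg (f : ℝ × ℝ → ℝ) (p : ℝ × ℝ) : Dx (fun q => -f q) p = -Dx f p := by
  simpa using Dx_const_mul (-1) f p

theorem Dx_const (c : ℝ) (p : ℝ × ℝ) : Dx (fun _ => c) p = 0 := by simp [Dx]

theorem Dt_const (c : ℝ) (p : ℝ × ℝ) : Dt (fun _ => c) p = 0 := by simp [Dt]

/-- Each row of the evolution matrix after the first comes from the previous one by differentiating
in `x` and reducing `y_xxx`, so the first two rows of the identity hold automatically. The last row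
is `h0`, `h1`, `h2`. -/
theorem companion_evolution_flat {a b c : ℝ × ℝ → ℝ} (hU : IsOpen U) (ha : ContDiffOn ℝ ∞ a U)
    (hb : ContDiffOn ℝ ∞ b U) (hc : ContDiffOn ℝ ∞ c U) {p : ℝ × ℝ} (hp : p ∈ U)
    (h0 : heatOp a p + 2 * Dx c p * a p = 0)
    (h1 : heatOp b p + 2 * Dx a p + 2 * Dx c p * b p = 0)
    (h2 : heatOp c p + 2 * Dx b p + 2 * Dx c p * c p = 0) (i j : Fin 3) :
    Dt (fun q => companionMatrix a b c q i j) p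
        + (companionMatrix a b c p * evolutionMatrix a b c p) i j
      = Dx (fun q => evolutionMatrix a b c q i j) p
        + (evolutionMatrix a b c p * companionMatrix a b c p) i j := by
  have da := ha.differentiableAt_of_isOpen hU hp
  have db := hb.differentiableAt_of_isOpen hU hp
  have dc := hc.differentiableAt_of_isOpen hU hp
  have da' := (ha.Dx hU).differentiableAt_of_isOpen hU hp
  have db' := (hb.Dx hU).differentiableAt_of_isOpen hU hp
  have dc' := (hc.Dx hU).differentiableAt_of_isOpen hU hp
  have e0 : Dx (fun q => -(Dx a q + c q * a q)) p
      = -(Dx (Dx a) p + (Dx c p * a p + c p * Dx a p)) := by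
    rw [Dx_neg, ← Dx_mul dc da]
    exact congrArg _ (Dx_add da' (dc.mul da))
  have e1 : Dx (fun q => -(Dx b q + a q + c q * b q)) p
      = -(Dx (Dx b) p + Dx a p + (Dx c p * b p + c p * Dx b p)) := by
    rw [Dx_neg, ← Dx_mul dc db, ← Dx_add db' da]
    exact congrArg _ (Dx_add (db'.add da) (dc.mul db))
  have e2 : Dx (fun q => -(Dx c q + b q + c q * c q)) p
      = -(Dx (Dx c) p + Dx b p + (Dx c p * c p + c p * Dx c p)) := by
    rw [Dx_neg, ← Dx_mul dc dc, ← Dx_add dc' db]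
    exact congrArg _ (Dx_add (dc'.add db) (dc.mul dc))
  simp only [heatOp] at h0 h1 h2
  fin_cases i <;> fin_cases j <;>
    simp [companionMatrix, evolutionMatrix, Matrix.mul_apply, Fin.sum_univ_three, Dx_const,
      Dt_const, Dx_neg a, Dx_neg b, Dx_neg c, e0, e1, e2, -neg_add_rev]
  all_goals first
    | linear_combination h0
    | linear_combination h1
    | linear_combination h2
    | ring

/-- The companion form makes the rows of `Φ` equal to `v`, `v_x`, `v_xx`, so `W(v) = det Φ`; the
first row of the evolution matrix is the heat equation. -/
theorem exists_isHeatTriple_isRepresentedBy (hU : IsOpen U) (hUs : IsSimplyConnected U)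
    (h : SolvesDeterminingSystem U ξ0 η1 η0) :
    ∃ v : Fin 3 → ℝ × ℝ → ℝ, IsHeatTriple U v ∧ IsRepresentedBy U v ξ0 η1 η0 := by
  set a : ℝ × ℝ → ℝ := fun q => -(1 / 2) * η0 q with ha_def
  set b : ℝ × ℝ → ℝ := fun q => -1 * η1 q with hb_def
  have ha : ContDiffOn ℝ ∞ a U := contDiffOn_const.mul h.smooth_η0
  have hb : ContDiffOn ℝ ∞ b U := contDiffOn_const.mul h.smooth_η1
  have hc := h.smooth_ξ0
  have ha' := ha.Dx hU
  have hb' := hb.Dx hU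
  have hc' := hc.Dx hU
  obtain ⟨Φ, hs, hΦ⟩ := exists_fundamental_matrix (A := companionMatrix a b ξ0)
    (B := evolutionMatrix a b ξ0) hU hUs
    (fun i j => by
      fin_cases i <;> fin_cases j <;> simp [companionMatrix] <;>
        first | exact contDiffOn_const | assumption)
    (fun i j => by
      fin_cases i <;> fin_cases j <;> simp [evolutionMatrix, -neg_add_rev] <;> fun_prop)
    (fun p hp => companion_evolution_flat hU ha hb hc hp
      (by
        rw [ha_def, heatOp_const_mul, heatOp]
        linear_combination (-1 / 2) * h.eq3 p hp)
      (by
        rw [hb_def, ha_def, heatOp_const_mul, Dx_const_mul, heatOp]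
        linear_combination -h.eq2 p hp)
      (by
        rw [hb_def, Dx_const_mul, heatOp]
        linear_combination h.eq1 p hp))
  have x0 : ∀ i, ∀ p ∈ U, Dx (fun q => Φ q 0 i) p = Φ p 1 i := fun i p hp => by
    rw [((hΦ p hp).2 0 i).1]
    simp [companionMatrix, Matrix.mul_apply, Fin.sum_univ_three]
  have x1 : ∀ i, ∀ p ∈ U, Dx (fun q => Φ q 1 i) p = Φ p 2 i := fun i p hp => by
    rw [((hΦ p hp).2 1 i).1]
    simp [companionMatrix, Matrix.mul_apply, Fin.sum_univ_three]
  have x2 : ∀ i, ∀ p ∈ U, Dx (fun q => Φ q 2 i) p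
      = a p * Φ p 0 i + b p * Φ p 1 i + ξ0 p * Φ p 2 i := fun i p hp => by
    rw [((hΦ p hp).2 2 i).1]
    simp [companionMatrix, Matrix.mul_apply, Fin.sum_univ_three]
  have t0 : ∀ i, ∀ p ∈ U, Dt (fun q => Φ q 0 i) p = -Φ p 2 i := fun i p hp => by
    rw [((hΦ p hp).2 0 i).2]
    simp [evolutionMatrix, Matrix.mul_apply, Fin.sum_univ_three]
  set v : Fin 3 → ℝ × ℝ → ℝ := fun i q => Φ q 0 i with hv
  have d1 : ∀ i, Set.EqOn (DxT v i) (fun q => Φ q 1 i) U := fun i p hp => x0 i p hp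
  have d2 : ∀ i, Set.EqOn (DxT (DxT v) i) (fun q => Φ q 2 i) U := fun i p hp =>
    (Dx_congr hU (d1 i) hp).trans (x1 i p hp)
  have d3 : ∀ i, ∀ p ∈ U, DxT (DxT (DxT v)) i p
      = a p * Φ p 0 i + b p * Φ p 1 i + ξ0 p * Φ p 2 i := fun i p hp =>
    (Dx_congr hU (d2 i) hp).trans (x2 i p hp)
  have hvs : ∀ i, ContDiffOn ℝ ∞ (v i) U := fun i => hs 0 i
  have hW : ∀ p ∈ U, wronskian3 v p = (Φ p).det := fun p hp => by
    rw [wronskian3, det3_apply, Matrix.det_fin_three, d1 0 hp, d1 1 hp, d1 2 hp, d2 0 hp, d2 1 hp,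
      d2 2 hp]
    ring
  have hW0 : ∀ p ∈ U, wronskian3 v p ≠ 0 := fun p hp => hW p hp ▸ (hΦ p hp).1
  refine ⟨v, ⟨hvs, fun i p hp => ?_, ?_⟩, hW0, fun p hp => ?_, fun p hp => ?_, fun p hp => ?_⟩
  · have e : Dx (Dx (v i)) p = Φ p 2 i := d2 i hp
    rw [e, t0 i p hp, neg_add_cancel]
  -- A linear relation, differentiated twice in `x`, puts its coefficient vector in the kernel of
  -- the invertible matrix `Φ p`.
  · rw [Fintype.linearIndependent_iff]
    intro g hg
    obtain ⟨p, hp⟩ := hUs.nonempty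
    have z0 : ∀ q ∈ U, ∑ i, g i * Φ q 0 i = 0 := fun q hq => by
      simpa using congrFun hg ⟨q, hq⟩
    have hDx : ∀ k : Fin 3, (∀ q ∈ U, ∑ i, g i * Φ q k i = 0) → ∀ q ∈ U,
        ∑ i, g i * Dx (fun q => Φ q k i) q = 0 := fun k hk q hq => by
      have hd := HasDerivAt.fun_sum (u := Finset.univ) fun i _ =>
        (hasDerivAt_Dx ((hs k i).differentiableAt_of_isOpen hU hq)).const_mul (g i)
      have hz : Dx (fun q => ∑ i, g i * Φ q k i) q = Dx (fun _ => 0) q := Dx_congr hU hk hq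
      rw [Dx_const] at hz
      exact hd.deriv.symm.trans hz
    have z1 : ∀ q ∈ U, ∑ i, g i * Φ q 1 i = 0 := fun q hq =>
      (Finset.sum_congr rfl fun i _ => by rw [x0 i q hq]).trans (hDx 0 z0 q hq)
    have z2 : ∀ q ∈ U, ∑ i, g i * Φ q 2 i = 0 := fun q hq =>
      (Finset.sum_congr rfl fun i _ => by rw [x1 i q hq]).trans (hDx 1 z1 q hq)
    have := Matrix.eq_zero_of_mulVec_eq_zero (v := g) (hΦ p hp).1 (by
      ext k
      simp only [Matrix.mulVec, dotProduct, Pi.zero_apply]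
      simp_rw [mul_comm _ (g _)]
      fin_cases k
      · exact z0 p hp
      · exact z1 p hp
      · exact z2 p hp)
    exact congrFun this
  -- After substituting for `v_xxx`, only one of its three terms survives in each determinant: `c W`
  -- here, then `-b W` for `η¹` and `a W` for `η⁰`.
  · rw [eq_div_iff (hW0 p hp), Dx_wronskian3 hU hvs hp, wronskian3, det3_apply, det3_apply,
      d3 0 p hp, d3 1 p hp, d3 2 p hp, d1 0 hp, d1 1 hp, d1 2 hp, d2 0 hp, d2 1 hp, d2 2 hp]
    simp only [hv]
    ring
  · rw [eq_div_iff (hW0 p hp), wronskian3, det3_apply, det3_apply,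
      d3 0 p hp, d3 1 p hp, d3 2 p hp, d1 0 hp, d1 1 hp, d1 2 hp, d2 0 hp, d2 1 hp, d2 2 hp]
    simp only [hv, hb_def]
    ring
  · rw [← mul_div_assoc, eq_div_iff (hW0 p hp), wronskian3, wronskian3, det3_apply, det3_apply,
      d3 0 p hp, d3 1 p hp, d3 2 p hp, d1 0 hp, d1 1 hp, d1 2 hp, d2 0 hp, d2 1 hp, d2 2 hp]
    simp only [hv, ha_def]
    ring

end Representation

theorem theorem1 :
    (∀ (Ω : Set (ℝ × ℝ)) (ξ0 η1 η0 : ℝ × ℝ → ℝ), IsOpen Ω →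
      SolvesDeterminingSystem Ω ξ0 η1 η0 →
      ∀ U : Set (ℝ × ℝ), U ⊆ Ω → IsOpen U → IsSimplyConnected U →
        ∃ v : Fin 3 → ℝ × ℝ → ℝ, IsHeatTriple U v ∧ IsRepresentedBy U v ξ0 η1 η0) ∧
    (∀ (Ω : Set (ℝ × ℝ)) (ξ0 η1 η0 : ℝ × ℝ → ℝ) (v : Fin 3 → ℝ × ℝ → ℝ), IsOpen Ω →
      IsHeatTriple Ω v → IsRepresentedBy Ω v ξ0 η1 η0 →
      SolvesDeterminingSystem Ω ξ0 η1 η0) :=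
  ⟨fun _ _ _ _ _ h _ hUΩ hU hUs => exists_isHeatTriple_isRepresentedBy hU hUs (h.mono hUΩ),
    fun _ _ _ _ _ hΩ hv hr => solvesDeterminingSystem_of_isRepresentedBy hΩ hv hr⟩
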